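/- Let $(\Omega,\mathcal F,P)$ be a probability space and let $T:\Omega\to\Omega$ be a measurable bijection ($P$ need not be $T$-invariant). Write $\mathcal I=\{A\in\mathcal F: T^{-1}A=A\}$ and $P(\mathcal I)=\{P(A):A\in\mathcal I\}$. Call a probability $Q$ on $(\Omega,\mathcal F)$ ergodic if $Q(T^{-1}A)=Q(A)$ for all $A\in\mathcal F$ and $Q(A)\in\{0,1\}$ for all $A\in\mathcal I$. Assume that for every $A\in\mathcal F$ the limit $$\lim_{N\to\infty}\frac1N\sum_{i=0}^{N-1}P(T^{-i}A)$$ exists. Then the following statements are equivalent: (i) the set $P(\mathcal I)$ is finite; (ii) there is a finite partition $\alpha$ of $\Omega$ such that every $A\in\alpha$ satisfies $A\in\mathcal I$ and $P(A)>0$, and there is no $B\in\mathcal I$ with $B\subset A$ and $0<P(B)<P(A)$; (iii) there exist $n\in\mathbb N$, ergodic probabilities $Q_1,\dots,Q_n$ and a measurable partition $\{A_1,\dots,A_n\}$ of $\Omega$ with $P(A_j)>0$ for all $j$, such that for every bounded $\mathcal F$-measurable $f:\Omega\to\mathbb R$, $$\lim_{N\to\infty}\frac1N\sum_{i=0}^{N-1}f\circ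 T^i=\sum_{j=1}^n\Big(\int f\,dQ_j\Big)1_{A_j}\qquad P\text{-a.s.};$$ (iv) there exist $n\in\mathbb N$, ergodic probabilities $Q_1,\dots,Q_n$ and a measurable partition $\{A_1,\dots,A_n\}$ of $\Omega$ with $P(A_j)>0$ for all $j$, such that for all $B,C\in\mathcal F$, $$\lim_{N\to\infty}\frac1N\sum_{i=0}^{N-1}P(B\cap T^{-i}C)=\sum_{j=1}^nQ_j(C)\,P(A_j\cap B).$$ Moreover, (iii) and (iv) are each also equivalent to the same statement with the additional requirement that $A_1,\dots,A_n\in\mathcal I$. -/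

import Mathlib

open MeasureTheory Filter Topology

/-- The family `𝓘` of measurable sets `A` with `T⁻¹ A = A`. -/
def invariantSets {Ω : Type*} [MeasurableSpace Ω] (T : Ω → Ω) : Set (Set Ω) :=
  {A | MeasurableSet A ∧ T ⁻¹' A = A}

/-- Finite irreducible invariant set partition with respect to `P` and `T`. -/
structure IsFiniteIrreducibleInvariantPartition {Ω : Type*} [MeasurableSpace Ω]
    (P : Measure Ω) (T : Ω → Ω) (α : Set (Set Ω)) : Prop where
  finite : α.Finite
  isPartition : Setoid.IsPartition α
  pos : ∀ A ∈ α, 0 < P A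
  invariant : ∀ A ∈ α, A ∈ invariantSets T
  irreducible : ∀ A ∈ α, ¬ ∃ B ∈ invariantSets T, B ⊆ A ∧ 0 < P B ∧ P B < P A

/-- A measurable partition `A₁, …, Aₙ` of `Ω` into sets of positive `P`-measure. -/
structure IsPositivePartition {Ω : Type*} [MeasurableSpace Ω] (P : Measure Ω)
    {n : ℕ} (A : Fin n → Set Ω) : Prop where
  measurableSet : ∀ j, MeasurableSet (A j)
  disjoint : Pairwise fun i j => Disjoint (A i) (A j)
  iUnion_eq : ⋃ j, A j = Set.univ
  pos : ∀ j, 0 < P (A j)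

/-- `Q` is an ergodic (in particular `T`-invariant) probability, i.e. an element of `𝓜ᵉ(T)`. -/
def IsErgodicProbability {Ω : Type*} [MeasurableSpace Ω] (T : Ω → Ω) (Q : Measure Ω) : Prop :=
  IsProbabilityMeasure Q ∧ Ergodic T Q

/-- For every bounded measurable `f`, the averages `N⁻¹ ∑_{i < N} f ∘ T^i` converge
`P`-almost surely to `∑ j, (∫ f dQ_j) 1_{A_j}`. -/
def BirkhoffLimit {Ω : Type*} [MeasurableSpace Ω] (P : Measure Ω) (T : Ω → Ω)
    {n : ℕ} (Q : Fin n → Measure Ω) (A : Fin n → Set Ω) : Prop :=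
  ∀ f : Ω → ℝ, Measurable f → (∃ K : ℝ, ∀ ω, |f ω| ≤ K) →
    ∀ᵐ ω ∂P, Tendsto (fun N : ℕ => (N : ℝ)⁻¹ * ∑ i ∈ Finset.range N, f (T^[i] ω)) atTop
      (𝓝 (∑ j, (∫ x, f x ∂(Q j)) * (A j).indicator (fun _ => (1 : ℝ)) ω))

/-- For all measurable `B`, `C`, the averages `N⁻¹ ∑_{i < N} P(B ∩ T^{-i} C)` converge to
`∑ j, Q_j(C) P(A_j ∩ B)`. -/
def AsymptoticIndependence {Ω : Type*} [MeasurableSpace Ω] (P : Measure Ω) (T : Ω → Ω)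
    {n : ℕ} (Q : Fin n → Measure Ω) (A : Fin n → Set Ω) : Prop :=
  ∀ B C : Set Ω, MeasurableSet B → MeasurableSet C →
    Tendsto (fun N : ℕ => (N : ℝ)⁻¹ * ∑ i ∈ Finset.range N, P.real (B ∩ T^[i] ⁻¹' C)) atTop
      (𝓝 (∑ j, (Q j).real C * P.real (A j ∩ B)))

/-! By Nikodym's convergence theorem, the setwise limit of the averages of `P ∘ T^{-i}` is a measure
`ν`. It is `T`-invariant and agrees with `P` on `𝓘`, though not on all measurable sets. This turns
the non-stationary problem into a stationary one: whatever holds `ν`-a.e. outside an invariant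
exceptional set also holds `P`-a.e.

If `P(𝓘)` is finite, splitting `Ω` repeatedly ends in irreducible invariant cells. Irreducibility
makes each conditional measure `ν(· | A_j)` ergodic, so Birkhoff's theorem gives convergence
`ν`-a.e. on `A_j`. For bounded `f` the convergence set is invariant, hence convergence also holds
`P`-a.e. on `A_j`; this is (iii) with invariant cells.

Integrating (iii) for `f = 1_C` over `B` gives (iv). In (iv), taking `B = Ω` and `C ∈ 𝓘` makes every
`Q_j(C)` equal to 0 or 1, so `P(C)` is a subset sum of the `P(A_j)` and (i) follows. -/

/-- The running maximum `max_{0 ≤ k ≤ n} S_k` of the Birkhoff sums of `f`. -/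
def birkhoffMax {Ω : Type*} (T : Ω → Ω) (f : Ω → ℝ) : ℕ → Ω → ℝ
  | 0 => fun _ => 0
  | n + 1 => fun x => max 0 (f x + birkhoffMax T f n (T x))

/-! ### Maximal ergodic lemma and Birkhoff's theorem for ergodic measures. -/

section BirkhoffMax

variable {Ω : Type*} {T : Ω → Ω} {f : Ω → ℝ}

lemma birkhoffMax_nonneg (n : ℕ) (x : Ω) : 0 ≤ birkhoffMax T f n x := by
  cases n with
  | zero => exact le_rfl
  | succ n => exact le_max_left _ _

lemma birkhoffMax_le_succ (n : ℕ) (x : Ω) : birkhoffMax T f n x ≤ birkhoffMax T f (n + 1) x := by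
  induction n generalizing x with
  | zero => exact le_max_left _ _
  | succ n ih => exact max_le_max le_rfl (add_le_add le_rfl (ih (T x)))

lemma birkhoffMax_monotone (x : Ω) : Monotone fun n => birkhoffMax T f n x :=
  monotone_nat_of_le_succ fun n => birkhoffMax_le_succ n x

lemma birkhoffSum_le_birkhoffMax (n : ℕ) (x : Ω) : birkhoffSum T f n x ≤ birkhoffMax T f n x := by
  induction n generalizing x with
  | zero => simp [birkhoffMax]
  | succ n ih =>
    rw [birkhoffSum_succ']
    exact (add_le_add le_rfl (ih (T x))).trans (le_max_right _ _)

lemma measurable_birkhoffMax [MeasurableSpace Ω] (hT : Measurable T) (hf : Measurable f) (n : ℕ) :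
    Measurable (birkhoffMax T f n) := by
  induction n with
  | zero => exact measurable_const
  | succ n ih => exact measurable_const.max (hf.add (ih.comp hT))

lemma integrable_birkhoffMax [MeasurableSpace Ω] {Q : Measure Ω} (hT : MeasurePreserving T Q Q)
    (hf : Integrable f Q) (n : ℕ) : Integrable (birkhoffMax T f n) Q := by
  induction n with
  | zero => exact integrable_zero _ _ _
  | succ n ih =>
    exact (integrable_zero _ _ _).sup (hf.add (hT.integrable_comp_of_integrable ih))

/-- The set where the Birkhoff sums are unbounded above, expressed through their maxima. -/
def birkhoffUnbounded (T : Ω → Ω) (f : Ω → ℝ) : Set Ω :=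
  {x | ∀ C : ℕ, ∃ n, (C : ℝ) < birkhoffMax T f n x}

lemma measurableSet_birkhoffUnbounded [MeasurableSpace Ω] (hT : Measurable T)
    (hf : Measurable f) : MeasurableSet (birkhoffUnbounded T f) := by
  have : birkhoffUnbounded T f = ⋂ C : ℕ, ⋃ n, {x | (C : ℝ) < birkhoffMax T f n x} := by
    ext x
    simp [birkhoffUnbounded]
  rw [this]
  exact MeasurableSet.iInter fun C => MeasurableSet.iUnion fun n =>
    measurableSet_lt measurable_const (measurable_birkhoffMax hT hf n)

/-- Passing from `x` to `T x` changes the sums by the finite amount `f x`. Invariance lets the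
zero-one law for ergodic measures apply. -/
lemma preimage_birkhoffUnbounded : T ⁻¹' birkhoffUnbounded T f = birkhoffUnbounded T f := by
  ext x
  constructor
  · intro h C
    obtain ⟨D, hD⟩ := exists_nat_gt ((C : ℝ) - f x)
    obtain ⟨n, hn⟩ := h D
    exact ⟨n + 1, lt_of_lt_of_le (by linarith) (le_max_right _ _)⟩
  · intro h C
    obtain ⟨D, hD⟩ := exists_nat_gt ((C : ℝ) + f x)
    obtain ⟨n, hn⟩ := h D
    have hD0 : (0 : ℝ) ≤ D := D.cast_nonneg
    cases n with
    | zero => exact absurd hn (not_lt.2 hD0)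
    | succ n =>
      refine ⟨n, ?_⟩
      rcases lt_max_iff.1 hn with h1 | h1 <;> linarith

/-- **Maximal ergodic lemma**: if the Birkhoff sums are almost surely unbounded above, then the
integral of `f` is nonnegative. -/
lemma integral_nonneg_of_ae_birkhoffUnbounded [MeasurableSpace Ω] {Q : Measure Ω}
    (hT : MeasurePreserving T Q Q) (hf : Integrable f Q)
    (h : ∀ᵐ x ∂Q, x ∈ birkhoffUnbounded T f) : 0 ≤ ∫ x, f x ∂Q := by
  have hint := integrable_birkhoffMax hT hf
  have hcomp : ∀ n, Integrable (fun x => birkhoffMax T f n (T x)) Q := fun n =>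
    hT.integrable_comp_of_integrable (hint n)
  -- By invariance `∫ M_n ∘ T = ∫ M_n ≤ ∫ M_{n+1}`. The integrand is dominated by `|f|` and equals
  -- `f x` as soon as `M_n (T x) ≥ -f x`, so its limit is `f` on the unbounded set.
  have hle : ∀ n, 0 ≤ ∫ x, (birkhoffMax T f (n + 1) x - birkhoffMax T f n (T x)) ∂Q := by
    intro n
    have e : ∫ x, birkhoffMax T f n (T x) ∂Q = ∫ x, birkhoffMax T f n x ∂Q := by
      have := integral_map (μ := Q) (φ := T) (f := birkhoffMax T f n) hT.measurable.aemeasurable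
        (by rw [hT.map_eq]; exact (hint n).aestronglyMeasurable)
      rw [hT.map_eq] at this
      exact this.symm
    rw [integral_sub (hint _) (hcomp n), e, sub_nonneg]
    exact integral_mono (hint _) (hint _) fun x => birkhoffMax_le_succ n x
  refine ge_of_tendsto' (tendsto_integral_of_dominated_convergence (fun x => |f x|)
    (fun n => ((hint (n + 1)).sub (hcomp n)).aestronglyMeasurable) hf.abs ?_ ?_) hle
  · intro n
    refine Eventually.of_forall fun x => ?_
    have h0 := birkhoffMax_nonneg (T := T) (f := f) n (T x)
    change |max 0 (f x + birkhoffMax T f n (T x)) - birkhoffMax T f n (T x)| ≤ |f x|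
    rcases max_cases 0 (f x + birkhoffMax T f n (T x)) with ⟨e, h1⟩ | ⟨e, h1⟩
    · rw [e, abs_le]
      have := neg_le_abs (f x)
      constructor <;> linarith [abs_nonneg (f x)]
    · rw [e, add_sub_cancel_right]
  · filter_upwards [h] with x hx
    have hx' : T x ∈ birkhoffUnbounded T f := by
      rwa [← Set.mem_preimage, preimage_birkhoffUnbounded]
    obtain ⟨C, hC⟩ := exists_nat_gt (-f x)
    obtain ⟨n, hn⟩ := hx' C
    refine tendsto_const_nhds.congr' ?_
    filter_upwards [eventually_ge_atTop n] with m hm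
    have hmono : birkhoffMax T f n (T x) ≤ birkhoffMax T f m (T x) :=
      birkhoffMax_monotone (T x) hm
    change f x = max 0 (f x + birkhoffMax T f m (T x)) - birkhoffMax T f m (T x)
    rw [max_eq_right (by linarith)]
    ring

/-- If `f` has negative integral with respect to an ergodic measure, its Birkhoff sums are almost
surely bounded above. -/
lemma ae_exists_birkhoffSum_le [MeasurableSpace Ω] {Q : Measure Ω} (hT : Ergodic T Q)
    (hfm : Measurable f) (hf : Integrable f Q) (hneg : ∫ x, f x ∂Q < 0) :
    ∀ᵐ x ∂Q, ∃ C : ℕ, ∀ n, birkhoffSum T f n x ≤ C := by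
  rcases hT.ae_mem_or_ae_notMem (measurableSet_birkhoffUnbounded hT.measurable hfm)
    preimage_birkhoffUnbounded with h | h
  · exact absurd (integral_nonneg_of_ae_birkhoffUnbounded hT.toMeasurePreserving hf h)
      (not_le.2 hneg)
  · filter_upwards [h] with x hx
    simp only [birkhoffUnbounded, Set.mem_ofPred_eq, not_forall, not_exists, not_lt] at hx
    obtain ⟨C, hC⟩ := hx
    exact ⟨C, fun n => (birkhoffSum_le_birkhoffMax n x).trans (hC n)⟩

/-- For `∫ f < d < c`, the sums of `f - d` are a.s. bounded by some `C`, so the averages of `f` are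
at most `C / N + d`. -/
lemma ae_eventually_average_lt [MeasurableSpace Ω] {Q : Measure Ω} [IsProbabilityMeasure Q]
    (hT : Ergodic T Q) (hfm : Measurable f) (hf : Integrable f Q) {c : ℝ}
    (hc : ∫ x, f x ∂Q < c) :
    ∀ᵐ x ∂Q, ∀ᶠ N : ℕ in atTop, (N : ℝ)⁻¹ * ∑ i ∈ Finset.range N, f (T^[i] x) < c := by
  obtain ⟨d, hd, hdc⟩ := exists_between hc
  have key := ae_exists_birkhoffSum_le (f := fun x => f x - d) hT (hfm.sub_const d)
    (hf.sub (integrable_const d)) (by rw [integral_sub hf (integrable_const d)]; simpa using hd)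
  filter_upwards [key] with x hx
  obtain ⟨C, hC⟩ := hx
  have hlim : Tendsto (fun N : ℕ => (N : ℝ)⁻¹ * C + d) atTop (𝓝 (0 * C + d)) :=
    (tendsto_inv_atTop_nhds_zero_nat.mul_const _).add_const _
  rw [zero_mul, zero_add] at hlim
  filter_upwards [hlim.eventually (gt_mem_nhds hdc), eventually_gt_atTop 0] with N hN hN0
  refine lt_of_le_of_lt ?_ hN
  have hNpos : (0 : ℝ) < N := by exact_mod_cast hN0
  have h1 := hC N
  simp only [birkhoffSum, Finset.sum_sub_distrib, Finset.sum_const, Finset.card_range,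
    nsmul_eq_mul] at h1
  calc (N : ℝ)⁻¹ * ∑ i ∈ Finset.range N, f (T^[i] x) ≤ (N : ℝ)⁻¹ * (C + N * d) := by
        gcongr; linarith
    _ = (N : ℝ)⁻¹ * C + d := by field_simp

/-- **Birkhoff's pointwise ergodic theorem** for ergodic probability measures. -/
theorem ae_tendsto_average_of_ergodic [MeasurableSpace Ω] {Q : Measure Ω} [IsProbabilityMeasure Q]
    (hT : Ergodic T Q) (hfm : Measurable f) (hf : Integrable f Q) :
    ∀ᵐ x ∂Q, Tendsto (fun N : ℕ => (N : ℝ)⁻¹ * ∑ i ∈ Finset.range N, f (T^[i] x)) atTop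
      (𝓝 (∫ x, f x ∂Q)) := by
  have hpos : ∀ n : ℕ, (0 : ℝ) < 1 / ((n : ℝ) + 1) := fun n => Nat.one_div_pos_of_nat
  have hup := ae_all_iff.2 fun n : ℕ => ae_eventually_average_lt hT hfm hf
    (c := ∫ x, f x ∂Q + 1 / ((n : ℝ) + 1)) (by linarith [hpos n])
  have hlow := ae_all_iff.2 fun n : ℕ => ae_eventually_average_lt (f := fun x => -f x) hT hfm.neg
    hf.neg (c := -∫ x, f x ∂Q + 1 / ((n : ℝ) + 1))
    (by rw [integral_neg]; linarith [hpos n])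
  filter_upwards [hup, hlow] with x hx1 hx2
  rw [Metric.tendsto_nhds]
  intro ε hε
  obtain ⟨n, hn⟩ := exists_nat_one_div_lt hε
  filter_upwards [hx1 n, hx2 n] with N h1 h2
  rw [Finset.sum_neg_distrib, mul_neg] at h2
  rw [Real.dist_eq, abs_lt]
  constructor <;> linarith

end BirkhoffMax

/-! ### Nikodym's theorem on setwise limits of measures. -/

section SetwiseLimit

variable {Ω : Type*} [MeasurableSpace Ω] {μ : ℕ → Measure Ω} {l : Set Ω → ℝ}

lemma setwiseLimit_nonneg
    (h : ∀ A, MeasurableSet A → Tendsto (fun n => (μ n).real A) atTop (𝓝 (l A)))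
    {A : Set Ω} (hA : MeasurableSet A) : 0 ≤ l A :=
  ge_of_tendsto' (h A hA) fun _ => measureReal_nonneg

variable [∀ n, IsFiniteMeasure (μ n)]

lemma setwiseLimit_mono
    (h : ∀ A, MeasurableSet A → Tendsto (fun n => (μ n).real A) atTop (𝓝 (l A)))
    {A B : Set Ω} (hA : MeasurableSet A) (hB : MeasurableSet B) (hAB : A ⊆ B) : l A ≤ l B :=
  le_of_tendsto_of_tendsto' (h A hA) (h B hB) fun _ => measureReal_mono hAB

lemma setwiseLimit_union
    (h : ∀ A, MeasurableSet A → Tendsto (fun n => (μ n).real A) atTop (𝓝 (l A)))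
    {A B : Set Ω} (hA : MeasurableSet A) (hB : MeasurableSet B) (hAB : Disjoint A B) :
    l (A ∪ B) = l A + l B :=
  tendsto_nhds_unique (h _ (hA.union hB))
    (((h A hA).add (h B hB)).congr fun _ => (measureReal_union hAB hB).symm)

lemma tendsto_measureReal_of_antitone {ν : Measure Ω} [IsFiniteMeasure ν] {E : ℕ → Set Ω}
    (hE : ∀ k, MeasurableSet (E k)) (hanti : Antitone E) (hinter : ⋂ k, E k = ∅) :
    Tendsto (fun k => ν.real (E k)) atTop (𝓝 0) := by
  have := tendsto_measure_iInter_atTop (μ := ν) (fun k => (hE k).nullMeasurableSet) hanti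
    ⟨0, measure_ne_top _ _⟩
  rw [hinter, measure_empty] at this
  exact (ENNReal.tendsto_toReal ENNReal.zero_ne_top).comp this

/-- Gliding hump: a setwise limit of finite measures is not bounded below by `10 δ` and above by
`11 δ` along a decreasing sequence of sets with empty intersection. -/
lemma setwiseLimit_no_gliding_hump
    (h : ∀ A, MeasurableSet A → Tendsto (fun n => (μ n).real A) atTop (𝓝 (l A)))
    {E : ℕ → Set Ω} (hE : ∀ k, MeasurableSet (E k)) (hanti : Antitone E) (hinter : ⋂ k, E k = ∅)
    {δ : ℝ} (hδ : 0 < δ) (hlow : ∀ k, 10 * δ ≤ l (E k)) (hup : l (E 0) < 11 * δ) : False := by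
  -- For a late measure `μ N`, almost all the mass of `E 0` lies in `E m`, yet continuity of this
  -- single measure at `∅` leaves little in `E m'`.
  have step : ∀ j m : ℕ, ∃ N m', j ≤ N ∧ m < m' ∧ 9 * δ < (μ N).real (E m) ∧
      (μ N).real (E 0) < 11 * δ ∧ (μ N).real (E m') < δ := by
    intro j m
    obtain ⟨N, h1, h2, h3⟩ := ((eventually_ge_atTop j).and
      (((h _ (hE m)).eventually (lt_mem_nhds (a := 9 * δ) (by linarith [hlow m]))).and
      ((h _ (hE 0)).eventually (gt_mem_nhds hup)))).exists
    obtain ⟨m', h4, h5⟩ := ((eventually_gt_atTop m).and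
      ((tendsto_measureReal_of_antitone (ν := μ N) hE hanti hinter).eventually
        (gt_mem_nhds hδ))).exists
    exact ⟨N, m', h1, h4, h2, h3, h5⟩
  choose N' m' hN hm h1 h2 h3 using step
  let m : ℕ → ℕ := fun j => Nat.rec 0 (fun j mj => m' j mj) j
  let N : ℕ → ℕ := fun j => N' j (m j)
  have hmsucc : ∀ j, m (j + 1) = m' j (m j) := fun j => rfl
  have hmono : StrictMono m := strictMono_nat_of_lt_succ fun j => hm j (m j)
  -- The union of the even blocks. Along even `j` it contains a block of mass above `8 δ`; along odd
  -- `j` it misses such a block inside `E 0`, leaving less than `11 δ - 8 δ`. Hence `μ n C` cannot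
  -- converge.
  let C : Set Ω := ⋃ i, E (m (2 * i)) \ E (m (2 * i + 1))
  have hC : MeasurableSet C := MeasurableSet.iUnion fun i => (hE _).diff (hE _)
  have hblock : ∀ j, 8 * δ < (μ (N j)).real (E (m j) \ E (m (j + 1))) := by
    intro j
    rw [measureReal_sdiff (hanti (hmono.monotone (Nat.le_succ j))) (hE _)]
    have := h1 j (m j)
    have := h3 j (m j)
    rw [← hmsucc] at this
    simp only [N]
    linarith
  have hNlim : Tendsto N atTop atTop := tendsto_atTop_mono (fun j => hN j (m j)) tendsto_id
  have hlim := (h C hC).comp hNlim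
  have heven : 8 * δ ≤ l C := by
    refine ge_of_tendsto' (hlim.comp (tendsto_id.const_mul_atTop' (r := 2) two_pos)) fun i => ?_
    exact (hblock (2 * i)).le.trans (measureReal_mono (Set.subset_iUnion
      (fun i => E (m (2 * i)) \ E (m (2 * i + 1))) i))
  have hodd : l C ≤ 3 * δ := by
    refine le_of_tendsto' (hlim.comp (tendsto_atTop_mono (f := id) (g := fun i => 2 * i + 1)
      (fun i => by simp only [id]; omega) tendsto_id)) fun i => ?_
    have hdisj : Disjoint C (E (m (2 * i + 1)) \ E (m (2 * i + 1 + 1))) := by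
      rw [Set.disjoint_left]
      rintro x hx ⟨hx1, hx2⟩
      obtain ⟨k, hk1, hk2⟩ := Set.mem_iUnion.1 hx
      rcases le_or_gt k i with hki | hki
      · exact hk2 (hanti (hmono.monotone (by omega : 2 * k + 1 ≤ 2 * i + 1)) hx1)
      · exact hx2 (hanti (hmono.monotone (by omega : 2 * i + 1 + 1 ≤ 2 * k)) hk1)
    have hsub : C ∪ E (m (2 * i + 1)) \ E (m (2 * i + 1 + 1)) ⊆ E 0 :=
      Set.union_subset (Set.iUnion_subset fun k => Set.sdiff_subset.trans (hanti (Nat.zero_le _)))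
        (Set.sdiff_subset.trans (hanti (Nat.zero_le _)))
    have h4 := measureReal_mono (μ := μ (N (2 * i + 1))) hsub
    rw [measureReal_union hdisj ((hE _).diff (hE _))] at h4
    have h5 := hblock (2 * i + 1)
    have h6 : (μ (N (2 * i + 1))).real (E 0) < 11 * δ := h2 _ _
    simp only [Function.comp]
    linarith
  linarith

/-- A setwise limit of finite measures is continuous at the empty set. -/
lemma tendsto_setwiseLimit_of_antitone
    (h : ∀ A, MeasurableSet A → Tendsto (fun n => (μ n).real A) atTop (𝓝 (l A)))
    {E : ℕ → Set Ω} (hE : ∀ k, MeasurableSet (E k)) (hanti : Antitone E)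
    (hinter : ⋂ k, E k = ∅) : Tendsto (fun k => l (E k)) atTop (𝓝 0) := by
  have hl : Antitone fun k => l (E k) := fun i j hij => setwiseLimit_mono h (hE j) (hE i) (hanti hij)
  have hbdd : BddBelow (Set.range fun k => l (E k)) :=
    ⟨0, by rintro _ ⟨k, rfl⟩; exact setwiseLimit_nonneg h (hE k)⟩
  have hlim := tendsto_atTop_ciInf hl hbdd
  set c := ⨅ k, l (E k) with hc
  have hc0 : 0 ≤ c := le_ciInf fun k => setwiseLimit_nonneg h (hE k)
  rcases hc0.eq_or_lt with h0 | h0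
  · rwa [← h0] at hlim
  · exfalso
    obtain ⟨k, hk⟩ := (hlim.eventually (gt_mem_nhds (by linarith : c < 11 * (c / 10)))).exists
    -- A tail of the sequence starts below `11 δ` with `10 δ = c`, the positive infimum.
    refine setwiseLimit_no_gliding_hump h (E := fun i => E (k + i)) (δ := c / 10)
      (fun i => hE _) (fun i j hij => hanti (by omega)) ?_ (by positivity) (fun i => ?_) hk
    · refine Set.subset_eq_empty (fun x hx => ?_) hinter
      refine Set.mem_iInter.2 fun i => ?_
      exact hanti (Nat.le_add_left i k) (Set.mem_iInter.1 hx i)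
    · have := ciInf_le hbdd (k + i)
      linarith

/-- Finite additivity expresses partial sums through the tails `E n`, which decrease to `∅`;
continuity there gives countable additivity. -/
lemma hasSum_setwiseLimit
    (h : ∀ A, MeasurableSet A → Tendsto (fun n => (μ n).real A) atTop (𝓝 (l A)))
    {B : ℕ → Set Ω} (hB : ∀ k, MeasurableSet (B k)) (hd : Pairwise (Function.onFun Disjoint B)) :
    HasSum (fun k => l (B k)) (l (⋃ k, B k)) := by
  rw [hasSum_iff_tendsto_nat_of_nonneg fun k => setwiseLimit_nonneg h (hB k)]
  let E : ℕ → Set Ω := fun n => ⋃ k, B (n + k)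
  have hE : ∀ n, MeasurableSet (E n) := fun n => MeasurableSet.iUnion fun k => hB _
  have hEsucc : ∀ n, E n = B n ∪ E (n + 1) := by
    intro n
    ext x
    simp only [E, Set.mem_iUnion, Set.mem_union]
    constructor
    · rintro ⟨k, hk⟩
      cases k with
      | zero => exact Or.inl hk
      | succ k => exact Or.inr ⟨k, by rwa [show n + 1 + k = n + (k + 1) by omega]⟩
    · rintro (hx | ⟨k, hk⟩)
      · exact ⟨0, hx⟩
      · exact ⟨k + 1, by rwa [show n + (k + 1) = n + 1 + k by omega]⟩
  have hsum : ∀ n, ∑ k ∈ Finset.range n, l (B k) = l (⋃ k, B k) - l (E n) := by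
    intro n
    induction n with
    | zero => simp [E]
    | succ n ih =>
      have hdis : Disjoint (B n) (E (n + 1)) :=
        Set.disjoint_iUnion_right.2 fun k => hd (by omega)
      rw [Finset.sum_range_succ, ih, hEsucc n, setwiseLimit_union h (hB n) (hE _) hdis]
      ring
  have hanti : Antitone E := antitone_nat_of_succ_le fun n => by
    rw [hEsucc n]; exact Set.subset_union_right
  have hinter : ⋂ n, E n = ∅ := by
    rw [Set.eq_empty_iff_forall_notMem]
    intro x hx
    rw [Set.mem_iInter] at hx
    obtain ⟨k, hk⟩ := Set.mem_iUnion.1 (hx 0)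
    obtain ⟨i, hi⟩ := Set.mem_iUnion.1 (hx (0 + k + 1))
    exact Set.disjoint_left.1 (hd (by omega : 0 + k ≠ 0 + k + 1 + i)) hk hi
  simp only [hsum]
  simpa using (tendsto_setwiseLimit_of_antitone h hE hanti hinter).const_sub (l (⋃ k, B k))

/-- **Nikodym convergence theorem**: a setwise limit of finite measures is a measure. -/
theorem exists_measure_of_setwiseLimit
    (h : ∀ A, MeasurableSet A → Tendsto (fun n => (μ n).real A) atTop (𝓝 (l A))) :
    ∃ ν : Measure Ω, IsFiniteMeasure ν ∧ ∀ A, MeasurableSet A → ν.real A = l A := by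
  have hempty : l ∅ = 0 := by
    have := setwiseLimit_union h MeasurableSet.empty MeasurableSet.empty (Set.disjoint_empty ∅)
    rw [Set.union_empty] at this
    linarith
  let ν : Measure Ω := Measure.ofMeasurable (fun A _ => ENNReal.ofReal (l A)) (by simp [hempty])
    (fun B hB hd => by
      have hs := hasSum_setwiseLimit h hB hd
      rw [← hs.tsum_eq, ENNReal.ofReal_tsum_of_nonneg
        (fun k => setwiseLimit_nonneg h (hB k)) hs.summable])
  have hν : ∀ A, MeasurableSet A → ν A = ENNReal.ofReal (l A) := fun A hA =>
    Measure.ofMeasurable_apply A hA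
  refine ⟨ν, ⟨by rw [hν _ MeasurableSet.univ]; exact ENNReal.ofReal_lt_top⟩, fun A hA => ?_⟩
  rw [measureReal_def, hν A hA, ENNReal.toReal_ofReal (setwiseLimit_nonneg h hA)]

end SetwiseLimit

/-! ### Stability of the invariant sets. -/

section InvariantSets

variable {Ω : Type*} [MeasurableSpace Ω] {T : Ω → Ω}

lemma inter_mem_invariantSets {A B : Set Ω} (hA : A ∈ invariantSets T)
    (hB : B ∈ invariantSets T) : A ∩ B ∈ invariantSets T :=
  ⟨hA.1.inter hB.1, by rw [Set.preimage_inter, hA.2, hB.2]⟩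

lemma sdiff_mem_invariantSets {A B : Set Ω} (hA : A ∈ invariantSets T)
    (hB : B ∈ invariantSets T) : A \ B ∈ invariantSets T :=
  ⟨hA.1.diff hB.1, by rw [Set.preimage_sdiff, hA.2, hB.2]⟩

lemma preimage_iterate_of_mem_invariantSets {A : Set Ω} (hA : A ∈ invariantSets T) (n : ℕ) :
    T^[n] ⁻¹' A = A := by
  rw [Set.preimage_iterate_eq]
  exact Function.iterate_fixed hA.2 n

end InvariantSets

/-! ### The invariant measure obtained from Cesàro averages. -/

section MeanMeasure

variable {Ω : Type*} [MeasurableSpace Ω] {P : Measure Ω} {T : Ω → Ω}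

/-- The averaged measure `N⁻¹ ∑_{i < N} P ∘ T^{-i}`. -/
noncomputable def meanMeasure (P : Measure Ω) (T : Ω → Ω) (N : ℕ) : Measure Ω :=
  (N : NNReal)⁻¹ • ∑ i ∈ Finset.range N, P.map T^[i]

instance [IsFiniteMeasure P] (N : ℕ) : IsFiniteMeasure (meanMeasure P T N) := by
  unfold meanMeasure
  infer_instance

lemma meanMeasure_real [IsFiniteMeasure P] (hT : Measurable T) (N : ℕ) {A : Set Ω}
    (hA : MeasurableSet A) :
    (meanMeasure P T N).real A = (N : ℝ)⁻¹ * ∑ i ∈ Finset.range N, P.real (T^[i] ⁻¹' A) := by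
  have hsum : (∑ i ∈ Finset.range N, P.map T^[i]).real A
      = ∑ i ∈ Finset.range N, P.real (T^[i] ⁻¹' A) := by
    rw [measureReal_def, Measure.finsetSum_apply, ENNReal.toReal_sum fun i _ => measure_ne_top _ _]
    refine Finset.sum_congr rfl fun i _ => ?_
    rw [Measure.map_apply (hT.iterate i) hA, measureReal_def]
  rw [meanMeasure, measureReal_nnreal_smul_apply, hsum]
  simp

/-- If the averages of `P ∘ T^{-i}` converge setwise, their limit is a `T`-invariant measure which
agrees with `P` on the invariant sets. -/
theorem exists_invariant_measure_of_tendsto [IsFiniteMeasure P] (hT : Measurable T)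
    (hlim : ∀ A : Set Ω, MeasurableSet A → ∃ l : ℝ,
      Tendsto (fun N : ℕ => (N : ℝ)⁻¹ * ∑ i ∈ Finset.range N, P.real (T^[i] ⁻¹' A)) atTop (𝓝 l)) :
    ∃ ν : Measure Ω, IsFiniteMeasure ν ∧ MeasurePreserving T ν ν ∧
      ∀ A ∈ invariantSets T, ν A = P A := by
  classical
  choose! l hl using hlim
  obtain ⟨ν, hν, hνl⟩ := exists_measure_of_setwiseLimit (μ := meanMeasure P T) (l := l)
    fun A hA => by simpa only [meanMeasure_real hT _ hA] using hl A hA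
  refine ⟨ν, hν, ⟨hT, Measure.ext fun A hA => ?_⟩, fun A hA => ?_⟩
  · rw [Measure.map_apply hT hA]
    refine (measureReal_eq_measureReal_iff (measure_ne_top _ _) (measure_ne_top _ _)).1 ?_
    rw [hνl _ hA, hνl _ (hT hA)]
    -- Telescoping: the averages at `T ⁻¹' A` and at `A` differ by a boundary term of order `1 / N`.
    have hshift : ∀ N : ℕ, (N : ℝ)⁻¹ * ∑ i ∈ Finset.range N, P.real (T^[i] ⁻¹' (T ⁻¹' A))
        = (N : ℝ)⁻¹ * ∑ i ∈ Finset.range N, P.real (T^[i] ⁻¹' A)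
          + (N : ℝ)⁻¹ * (P.real (T^[N] ⁻¹' A) - P.real A) := by
      intro N
      have e : ∀ i, T^[i] ⁻¹' (T ⁻¹' A) = T^[i + 1] ⁻¹' A := fun i => by
        rw [Function.iterate_succ', Set.preimage_comp]
      have h1 := Finset.sum_range_succ (fun i => P.real (T^[i] ⁻¹' A)) N
      rw [Finset.sum_range_succ'] at h1
      simp only [Function.iterate_zero, Set.preimage_id] at h1
      simp only [e, ← mul_add]
      congr 1
      linarith
    have hzero : Tendsto (fun N : ℕ => (N : ℝ)⁻¹ * (P.real (T^[N] ⁻¹' A) - P.real A)) atTop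
        (𝓝 0) := by
      refine tendsto_inv_atTop_nhds_zero_nat.zero_mul_isBoundedUnder_le ?_
      refine isBoundedUnder_of ⟨P.real Set.univ, fun N => ?_⟩
      have h1 : P.real (T^[N] ⁻¹' A) ≤ P.real Set.univ := measureReal_mono (Set.subset_univ _)
      have h2 : P.real A ≤ P.real Set.univ := measureReal_mono (Set.subset_univ _)
      have h3 : 0 ≤ P.real (T^[N] ⁻¹' A) := measureReal_nonneg
      have h4 : 0 ≤ P.real A := measureReal_nonneg
      simp only [Function.comp, Real.norm_eq_abs, abs_le]
      constructor <;> linarith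
    refine tendsto_nhds_unique (hl _ (hT hA)) ?_
    simpa only [hshift, add_zero] using (hl A hA).add hzero
  · refine (measureReal_eq_measureReal_iff (measure_ne_top _ _) (measure_ne_top _ _)).1 ?_
    rw [hνl A hA.1]
    refine tendsto_nhds_unique (hl A hA.1) (tendsto_const_nhds.congr' ?_)
    filter_upwards [eventually_gt_atTop 0] with N hN
    have hN' : (N : ℝ) ≠ 0 := by exact_mod_cast hN.ne'
    simp only [preimage_iterate_of_mem_invariantSets hA, Finset.sum_const, Finset.card_range,
      nsmul_eq_mul]
    field_simp

end MeanMeasure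

/-! ### Irreducible partitions and ergodicity of the conditional measures. -/

section Irreducible

variable {Ω : Type*} [MeasurableSpace Ω] {P : Measure Ω} {T : Ω → Ω}

/-- Every nonnull invariant set splits into finitely many irreducible ones, provided that `P` takes
finitely many values on its invariant subsets. -/
lemma exists_irreducible_splitting [IsFiniteMeasure P]
    (hfin : ((fun A => P A) '' invariantSets T).Finite) {A : Set Ω} (hA : A ∈ invariantSets T)
    (hpos : 0 < P A) :
    ∃ α : Set (Set Ω), α.Finite ∧ α.PairwiseDisjoint id ∧ ⋃₀ α = A ∧ ∀ B ∈ α,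
      0 < P B ∧ B ∈ invariantSets T ∧ ¬ ∃ C ∈ invariantSets T, C ⊆ B ∧ 0 < P C ∧ P C < P B := by
  have hsubfin : ∀ A : Set Ω, ((fun C => P C) '' {C ∈ invariantSets T | C ⊆ A}).Finite := fun A =>
    hfin.subset (Set.image_mono fun C hC => hC.1)
  induction hk : ((fun C => P C) '' {C ∈ invariantSets T | C ⊆ A}).ncard using Nat.strong_induction_on
    generalizing A with
  | _ k ih =>
  by_cases hirr : ∃ C ∈ invariantSets T, C ⊆ A ∧ 0 < P C ∧ P C < P A
  · obtain ⟨B, hB, hBA, hB0, hBlt⟩ := hirr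
    -- Invariant subsets of `D` can no longer attain the value `P A`, so the number of values drops.
    have hcard : ∀ D ⊆ A, P D < P A →
        ((fun C => P C) '' {C ∈ invariantSets T | C ⊆ D}).ncard < k := by
      intro D hDA hD
      rw [← hk]
      refine Set.ncard_lt_ncard ?_ (hsubfin A)
      refine ⟨Set.image_mono fun C hC => ⟨hC.1, hC.2.trans hDA⟩, fun hsub => ?_⟩
      obtain ⟨C, hC, hCA⟩ := hsub ⟨A, ⟨hA, subset_rfl⟩, rfl⟩
      exact absurd (measure_mono (μ := P) hC.2) (not_le.2 (by rw [show P C = P A from hCA]; exact hD))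
    have hAB : A \ B ∈ invariantSets T := sdiff_mem_invariantSets hA hB
    have hsplit : P (A \ B) = P A - P B :=
      measure_sdiff hBA hB.1.nullMeasurableSet (measure_ne_top _ _)
    have hAB0 : 0 < P (A \ B) := by rw [hsplit]; exact tsub_pos_of_lt hBlt
    have hABlt : P (A \ B) < P A := by
      rw [hsplit]
      exact ENNReal.sub_lt_self (measure_ne_top _ _) hpos.ne' hB0.ne'
    obtain ⟨α, hα1, hα2, hα3, hα4⟩ := ih _ (hcard B hBA hBlt) hB hB0 rfl
    obtain ⟨β, hβ1, hβ2, hβ3, hβ4⟩ := ih _ (hcard _ Set.sdiff_subset hABlt) hAB hAB0 rfl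
    refine ⟨α ∪ β, hα1.union hβ1, ?_, ?_, ?_⟩
    · refine (Set.pairwiseDisjoint_union).2 ⟨hα2, hβ2, fun C hC D hD _ => ?_⟩
      exact Set.disjoint_of_subset (hα3 ▸ Set.subset_sUnion_of_mem hC)
        (hβ3 ▸ Set.subset_sUnion_of_mem hD) Set.disjoint_sdiff_right
    · rw [Set.sUnion_union, hα3, hβ3, Set.union_sdiff_cancel hBA]
    · rintro C (hC | hC)
      exacts [hα4 C hC, hβ4 C hC]
  · refine ⟨{A}, Set.finite_singleton A, Set.pairwiseDisjoint_singleton _ _, Set.sUnion_singleton A,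
      ?_⟩
    rintro B rfl
    exact ⟨hpos, hA, hirr⟩

lemma exists_isFiniteIrreducibleInvariantPartition [IsProbabilityMeasure P]
    (hfin : ((fun A => P A) '' invariantSets T).Finite) :
    ∃ α : Set (Set Ω), IsFiniteIrreducibleInvariantPartition P T α := by
  obtain ⟨α, h1, h2, h3, h4⟩ := exists_irreducible_splitting (P := P) (T := T) hfin
    (A := Set.univ) ⟨MeasurableSet.univ, Set.preimage_univ⟩ (by simp)
  refine ⟨α, h1, ⟨fun h => ?_, fun x => ?_⟩, fun A hA => (h4 A hA).1, fun A hA => (h4 A hA).2.1,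
    fun A hA => (h4 A hA).2.2⟩
  · simpa using (h4 ∅ h).1
  · obtain ⟨A, hA, hx⟩ := Set.mem_sUnion.1 (h3 ▸ Set.mem_univ x : x ∈ ⋃₀ α)
    exact ⟨A, ⟨hA, hx⟩, fun B hB => h2.elim_set hB.1 hA x hB.2 hx⟩

/-- An invariant `s` cuts `A` into invariant pieces, on which `ν` equals `P`; irreducibility makes
one of them null. -/
lemma isErgodicProbability_cond {ν : Measure Ω} [IsFiniteMeasure P] [IsFiniteMeasure ν]
    (hν : MeasurePreserving T ν ν) (hνP : ∀ A ∈ invariantSets T, ν A = P A) {A : Set Ω}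
    (hA : A ∈ invariantSets T) (hpos : 0 < P A)
    (hirr : ¬ ∃ B ∈ invariantSets T, B ⊆ A ∧ 0 < P B ∧ P B < P A) :
    IsErgodicProbability T (ProbabilityTheory.cond ν A) := by
  have hνA : ν A ≠ 0 := by rw [hνP A hA]; exact hpos.ne'
  refine ⟨ProbabilityTheory.cond_isProbabilityMeasure hνA, ?_, ⟨fun s hs hsT => ?_⟩⟩
  · have := hν.restrict_preimage hA.1
    rw [hA.2] at this
    exact this.smul_measure _
  · have hAs : A ∩ s ∈ invariantSets T := inter_mem_invariantSets hA ⟨hs, hsT⟩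
    rw [eventuallyConst_set']
    rcases eq_or_ne (P (A ∩ s)) 0 with h0 | h0
    · left
      rw [ae_eq_empty, ProbabilityTheory.cond_apply hA.1, hνP _ hAs, h0, mul_zero]
    · right
      have hle : P A ≤ P (A ∩ s) := not_lt.1 fun hlt =>
        hirr ⟨A ∩ s, hAs, Set.inter_subset_left, pos_iff_ne_zero.2 h0, hlt⟩
      have hdiff : A \ s ∈ invariantSets T := sdiff_mem_invariantSets hA ⟨hs, hsT⟩
      have hzero : P (A \ s) = 0 := by
        have := measure_inter_add_sdiff (μ := P) A hs
        rw [le_antisymm (measure_mono Set.inter_subset_left) hle] at this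
        exact (ENNReal.add_right_inj (measure_ne_top P A)).1 (this.trans (add_zero _).symm)
      rw [ae_eq_univ, ProbabilityTheory.cond_apply hA.1, ← Set.sdiff_eq, hνP _ hdiff, hzero,
        mul_zero]

end Irreducible

/-! ### Transfer from `ν` to `P`, and the remaining implications. -/

section Equivalences

variable {Ω : Type*} {T : Ω → Ω}

/-- The averages at `x` and `T x` differ by at most `2 K / N`. Thus the set of convergence to `c` is
invariant, as the passage from `ν` to `P` requires. -/
lemma tendsto_average_comp_iff {f : Ω → ℝ} {K : ℝ} (hK : ∀ ω, |f ω| ≤ K) (x : Ω) (c : ℝ) :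
    Tendsto (fun N : ℕ => (N : ℝ)⁻¹ * ∑ i ∈ Finset.range N, f (T^[i] (T x))) atTop (𝓝 c) ↔
      Tendsto (fun N : ℕ => (N : ℝ)⁻¹ * ∑ i ∈ Finset.range N, f (T^[i] x)) atTop (𝓝 c) := by
  refine (tendsto_iff_of_dist ?_)
  have hshift : ∀ N : ℕ, dist ((N : ℝ)⁻¹ * ∑ i ∈ Finset.range N, f (T^[i] (T x)))
      ((N : ℝ)⁻¹ * ∑ i ∈ Finset.range N, f (T^[i] x)) = |(N : ℝ)⁻¹ * (f (T^[N] x) - f x)| := by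
    intro N
    have h1 := Finset.sum_range_succ (fun i => f (T^[i] x)) N
    rw [Finset.sum_range_succ'] at h1
    simp only [Function.iterate_succ_apply, Function.iterate_zero, id] at h1
    rw [Real.dist_eq, ← mul_sub]
    congr 2
    linarith
  simp only [hshift]
  have : Tendsto (fun N : ℕ => (N : ℝ)⁻¹ * (f (T^[N] x) - f x)) atTop (𝓝 0) := by
    refine tendsto_inv_atTop_nhds_zero_nat.zero_mul_isBoundedUnder_le ?_
    refine isBoundedUnder_of ⟨K + K, fun N => ?_⟩
    exact (abs_sub _ _).trans (add_le_add (hK _) (hK _))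
  simpa using this.abs

lemma sum_mul_indicator_eq {n : ℕ} {A : Fin n → Set Ω}
    (hd : Pairwise fun i j => Disjoint (A i) (A j)) (q : Fin n → ℝ) {j : Fin n} {ω : Ω}
    (hω : ω ∈ A j) : ∑ i, q i * (A i).indicator (fun _ => (1 : ℝ)) ω = q j := by
  rw [Finset.sum_eq_single j]
  · simp [hω]
  · intro i _ hij
    rw [Set.indicator_of_notMem (Set.disjoint_right.1 (hd hij) hω), mul_zero]
  · simp

variable [MeasurableSpace Ω] {P : Measure Ω}

/-- If `ν` agrees with `P` on invariant sets and is ergodic on the invariant set `A`, then the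
Birkhoff averages converge `P`-almost surely on `A`. -/
lemma ae_tendsto_average_on_of_cond_ergodic {ν : Measure Ω} [IsFiniteMeasure ν]
    (hT : Measurable T) (hνP : ∀ A ∈ invariantSets T, ν A = P A) {A : Set Ω}
    (hA : A ∈ invariantSets T) (hQ : IsErgodicProbability T (ProbabilityTheory.cond ν A))
    {f : Ω → ℝ} (hf : Measurable f) {K : ℝ} (hK : ∀ ω, |f ω| ≤ K) :
    ∀ᵐ ω ∂P, ω ∈ A → Tendsto (fun N : ℕ => (N : ℝ)⁻¹ * ∑ i ∈ Finset.range N, f (T^[i] ω)) atTop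
      (𝓝 (∫ x, f x ∂(ProbabilityTheory.cond ν A))) := by
  obtain ⟨hprob, herg⟩ := hQ
  set c := ∫ x, f x ∂(ProbabilityTheory.cond ν A)
  let G : Set Ω := {ω | Tendsto (fun N : ℕ => (N : ℝ)⁻¹ * ∑ i ∈ Finset.range N, f (T^[i] ω)) atTop
    (𝓝 c)}
  have hGm : MeasurableSet G := measurableSet_tendsto _ fun N =>
    (Finset.measurable_fun_sum _ fun i _ => hf.comp (hT.iterate i)).const_mul _
  have hG : G ∈ invariantSets T :=
    ⟨hGm, Set.ext fun x => tendsto_average_comp_iff hK x c⟩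
  have hae : ∀ᵐ x ∂(ProbabilityTheory.cond ν A), x ∈ G :=
    ae_tendsto_average_of_ergodic herg hf
      (Integrable.of_bound hf.aestronglyMeasurable K (Eventually.of_forall hK))
  have hνA : ν A ≠ 0 := fun h0 => by
    have : ProbabilityTheory.cond ν A = 0 := ProbabilityTheory.cond_eq_zero_of_meas_eq_zero h0
    exact IsProbabilityMeasure.ne_zero _ this
  have hnull : ν (A \ G) = 0 := by
    have h0 : ProbabilityTheory.cond ν A Gᶜ = 0 := hae
    rw [ProbabilityTheory.cond_apply hA.1, mul_eq_zero, ENNReal.inv_eq_zero] at h0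
    exact h0.resolve_left (measure_ne_top _ _)
  -- The exceptional set is itself invariant, so its `ν`-nullity is `P`-nullity.
  rw [hνP _ (sdiff_mem_invariantSets hA hG)] at hnull
  rw [ae_iff]
  refine measure_mono_null (fun x hx => ?_) hnull
  exact Classical.not_imp.1 hx

lemma exists_birkhoffLimit_of_partition [IsFiniteMeasure P] (hT : Measurable T)
    (hlim : ∀ A : Set Ω, MeasurableSet A → ∃ l : ℝ,
      Tendsto (fun N : ℕ => (N : ℝ)⁻¹ * ∑ i ∈ Finset.range N, P.real (T^[i] ⁻¹' A)) atTop (𝓝 l))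
    {α : Set (Set Ω)} (hα : IsFiniteIrreducibleInvariantPartition P T α) :
    ∃ (n : ℕ) (Q : Fin n → Measure Ω) (A : Fin n → Set Ω),
      (∀ j, IsErgodicProbability T (Q j)) ∧ IsPositivePartition P A ∧
        (∀ j, A j ∈ invariantSets T) ∧ BirkhoffLimit P T Q A := by
  obtain ⟨ν, hνfin, hν, hνP⟩ := exists_invariant_measure_of_tendsto hT hlim
  have := hα.finite.to_subtype
  obtain ⟨n, ⟨e⟩⟩ := Finite.exists_equiv_fin α
  let A : Fin n → Set Ω := fun j => (e.symm j).1
  have hmem : ∀ j, A j ∈ α := fun j => (e.symm j).2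
  have hinv : ∀ j, A j ∈ invariantSets T := fun j => hα.invariant _ (hmem j)
  have hQ : ∀ j, IsErgodicProbability T (ProbabilityTheory.cond ν (A j)) := fun j =>
    isErgodicProbability_cond hν hνP (hinv j) (hα.pos _ (hmem j)) (hα.irreducible _ (hmem j))
  have hd : Pairwise fun i j => Disjoint (A i) (A j) := fun i j hij =>
    hα.isPartition.pairwiseDisjoint (hmem i) (hmem j) fun h =>
      hij (e.symm.injective (Subtype.ext h))
  have hU : ⋃ j, A j = Set.univ := by
    refine Set.eq_univ_of_forall fun x => ?_
    obtain ⟨B, ⟨hB, hx⟩, -⟩ := hα.isPartition.2 x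
    exact Set.mem_iUnion.2 ⟨e ⟨B, hB⟩, by simpa [A] using hx⟩
  refine ⟨n, fun j => ProbabilityTheory.cond ν (A j), A, hQ,
    ⟨fun j => (hinv j).1, hd, hU, fun j => hα.pos _ (hmem j)⟩, hinv, ?_⟩
  rintro f hf ⟨K, hK⟩
  filter_upwards [ae_all_iff.2 fun j =>
    ae_tendsto_average_on_of_cond_ergodic hT hνP (hinv j) (hQ j) hf hK] with ω hω
  obtain ⟨j, hj⟩ := Set.mem_iUnion.1 (hU ▸ Set.mem_univ ω : ω ∈ ⋃ j, A j)
  rw [sum_mul_indicator_eq hd (fun j => ∫ x, f x ∂(ProbabilityTheory.cond ν (A j))) hj]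
  exact hω j hj

/-- Dominated convergence for `f = 1_C` under `P.restrict B`, with bound 1. -/
lemma BirkhoffLimit.asymptoticIndependence [IsFiniteMeasure P] (hT : Measurable T) {n : ℕ}
    {Q : Fin n → Measure Ω} {A : Fin n → Set Ω} (hA : ∀ j, MeasurableSet (A j))
    (h : BirkhoffLimit P T Q A) : AsymptoticIndependence P T Q A := by
  intro B C hB hC
  have hint : ∀ D : Set Ω, MeasurableSet D →
      Integrable (D.indicator fun _ => (1 : ℝ)) (P.restrict B) := fun D hD =>
    (integrable_const 1).indicator hD
  have hval : ∀ D : Set Ω, MeasurableSet D →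
      ∫ ω, D.indicator (fun _ => (1 : ℝ)) ω ∂(P.restrict B) = P.real (D ∩ B) := fun D hD => by
    rw [integral_indicator_const _ hD, measureReal_restrict_apply hD, smul_eq_mul, mul_one]
  have hind : ∀ (i : ℕ) (ω : Ω), C.indicator (fun _ => (1 : ℝ)) (T^[i] ω)
      = (T^[i] ⁻¹' C).indicator (fun _ => (1 : ℝ)) ω := fun i ω => rfl
  have hbound : ∀ ω, |C.indicator (fun _ => (1 : ℝ)) ω| ≤ 1 := fun ω => by
    by_cases hω : ω ∈ C <;> simp [hω]
  have hbirk := h (C.indicator fun _ => 1) (measurable_const.indicator hC) ⟨1, hbound⟩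
  simp only [hind] at hbirk
  have hlim := tendsto_integral_of_dominated_convergence (μ := P.restrict B) (fun _ => (1 : ℝ))
    (F := fun (N : ℕ) ω => (N : ℝ)⁻¹ *
      ∑ i ∈ Finset.range N, (T^[i] ⁻¹' C).indicator (fun _ => (1 : ℝ)) ω)
    (fun N => ((integrable_finsetSum _ fun i _ =>
      hint _ (hT.iterate i hC)).const_mul _).aestronglyMeasurable)
    (integrable_const 1)
    (fun N => Eventually.of_forall fun ω => ?_) (ae_restrict_of_ae hbirk)
  · have hleft : ∀ N : ℕ, ∫ ω, (N : ℝ)⁻¹ *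
        ∑ i ∈ Finset.range N, (T^[i] ⁻¹' C).indicator (fun _ => (1 : ℝ)) ω ∂(P.restrict B)
        = (N : ℝ)⁻¹ * ∑ i ∈ Finset.range N, P.real (B ∩ T^[i] ⁻¹' C) := fun N => by
      rw [integral_const_mul, integral_finsetSum _ fun i _ => hint _ (hT.iterate i hC)]
      simp only [hval _ (hT.iterate _ hC), Set.inter_comm]
    have hright : ∫ ω, ∑ j, (∫ x, C.indicator (fun _ => (1 : ℝ)) x ∂(Q j)) *
        (A j).indicator (fun _ => (1 : ℝ)) ω ∂(P.restrict B)
        = ∑ j, (Q j).real C * P.real (A j ∩ B) := by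
      rw [integral_finsetSum _ fun j _ => (hint _ (hA j)).const_mul _]
      refine Finset.sum_congr rfl fun j _ => ?_
      rw [integral_const_mul, hval _ (hA j), integral_indicator_const _ hC, smul_eq_mul, mul_one]
    simpa only [hleft, hright] using hlim
  · rw [norm_mul, norm_inv, Real.norm_natCast]
    refine (mul_le_mul_of_nonneg_left ((norm_sum_le _ _).trans
      (Finset.sum_le_sum fun i _ => hbound (T^[i] ω))) (by positivity)).trans ?_
    simpa using inv_mul_le_one (a := (N : ℝ))

lemma AsymptoticIndependence.finite_image_invariantSets [IsProbabilityMeasure P] {n : ℕ}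
    {Q : Fin n → Measure Ω} {A : Fin n → Set Ω} (hQ : ∀ j, IsErgodicProbability T (Q j))
    (h : AsymptoticIndependence P T Q A) : ((fun A => P A) '' invariantSets T).Finite := by
  have hval : ∀ C ∈ invariantSets T, P.real C = ∑ j, (Q j).real C * P.real (A j) := by
    intro C hC
    have := h Set.univ C MeasurableSet.univ hC.1
    simp only [Set.univ_inter, Set.inter_univ] at this
    refine tendsto_nhds_unique (tendsto_const_nhds.congr' ?_) this
    filter_upwards [eventually_gt_atTop 0] with N hN
    have hN' : (N : ℝ) ≠ 0 := by exact_mod_cast hN.ne'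
    simp only [preimage_iterate_of_mem_invariantSets hC, Finset.sum_const, Finset.card_range,
      nsmul_eq_mul]
    field_simp
  have hfin : (Set.range fun s : Finset (Fin n) =>
      ENNReal.ofReal (∑ j ∈ s, P.real (A j))).Finite := Set.finite_range _
  refine hfin.subset ?_
  rintro _ ⟨C, hC, rfl⟩
  classical
  -- Ergodicity forces `Q j C` to be 0 or 1, so only these indices contribute to `P C`.
  refine ⟨Finset.univ.filter fun j => Q j C = 1, ?_⟩
  have e : P.real C = ∑ j ∈ Finset.univ.filter fun j => Q j C = 1, P.real (A j) := by
    rw [hval C hC, Finset.sum_filter]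
    refine Finset.sum_congr rfl fun j _ => ?_
    have := (hQ j).1
    rcases (hQ j).2.toPreErgodic.prob_eq_zero_or_one hC.1 hC.2 with h0 | h0 <;>
      simp [measureReal_def, h0]
  simp only [← e]
  exact ofReal_measureReal

end Equivalences

theorem theorem6p4 {Ω : Type*} [MeasurableSpace Ω] (P : Measure Ω) [IsProbabilityMeasure P]
    (T : Ω → Ω) (hT : Measurable T) (hbij : Function.Bijective T)
    (hlim : ∀ A : Set Ω, MeasurableSet A → ∃ l : ℝ,
      Tendsto (fun N : ℕ => (N : ℝ)⁻¹ * ∑ i ∈ Finset.range N, P.real (T^[i] ⁻¹' A)) atTop (𝓝 l)) :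
    List.TFAE [
      -- (i)
      ((fun A => P A) '' invariantSets T).Finite,
      -- (ii)
      ∃ α : Set (Set Ω), IsFiniteIrreducibleInvariantPartition P T α,
      -- (iii)
      ∃ (n : ℕ) (Q : Fin n → Measure Ω) (A : Fin n → Set Ω),
        (∀ j, IsErgodicProbability T (Q j)) ∧ IsPositivePartition P A ∧ BirkhoffLimit P T Q A,
      -- (iii) with invariant cells
      ∃ (n : ℕ) (Q : Fin n → Measure Ω) (A : Fin n → Set Ω),
        (∀ j, IsErgodicProbability T (Q j)) ∧ IsPositivePartition P A ∧
          (∀ j, A j ∈ invariantSets T) ∧ BirkhoffLimit P T Q A,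
      -- (iv)
      ∃ (n : ℕ) (Q : Fin n → Measure Ω) (A : Fin n → Set Ω),
        (∀ j, IsErgodicProbability T (Q j)) ∧ IsPositivePartition P A ∧
          AsymptoticIndependence P T Q A,
      -- (iv) with invariant cells
      ∃ (n : ℕ) (Q : Fin n → Measure Ω) (A : Fin n → Set Ω),
        (∀ j, IsErgodicProbability T (Q j)) ∧ IsPositivePartition P A ∧
          (∀ j, A j ∈ invariantSets T) ∧ AsymptoticIndependence P T Q A] := by
  tfae_have 1 → 2 := exists_isFiniteIrreducibleInvariantPartition
  tfae_have 2 → 4 := fun ⟨_, hα⟩ => exists_birkhoffLimit_of_partition hT hlim hα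
  tfae_have 4 → 3 := fun ⟨n, Q, A, hQ, hA, _, h⟩ => ⟨n, Q, A, hQ, hA, h⟩
  tfae_have 3 → 5 := fun ⟨n, Q, A, hQ, hA, h⟩ =>
    ⟨n, Q, A, hQ, hA, h.asymptoticIndependence hT hA.measurableSet⟩
  tfae_have 4 → 6 := fun ⟨n, Q, A, hQ, hA, hinv, h⟩ =>
    ⟨n, Q, A, hQ, hA, hinv, h.asymptoticIndependence hT hA.measurableSet⟩
  tfae_have 6 → 5 := fun ⟨n, Q, A, hQ, hA, _, h⟩ => ⟨n, Q, A, hQ, hA, h⟩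
  tfae_have 5 → 1 := fun ⟨_, _, _, hQ, _, h⟩ => h.finite_image_invariantSets hQ
  tfae_finish
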